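/- Let $Q_n$, $n\ge 0$, be the Yablonskii--Vorob'ev polynomials, defined by $Q_0=1$, $Q_1=z$ and $$Q_{n+1}Q_{n-1}=zQ_n^2-4\bigl(Q_nQ_n''-(Q_n')^2\bigr)\qquad(n\ge 1).$$ These are indeed polynomials: at every step the right-hand side is divisible by $Q_{n-1}$. For every $m\ge 0$, $Q_m$ has degree $\tfrac12 m(m+1)$ and its complex roots are simple; denote them by $z_{m,k}$, $1\le k\le \tfrac12 m(m+1)$. For every $n\ge 1$, $Q_{n-1}$ and $Q_n$ have no common root, and the following relations hold. For every $1\le j\le \tfrac12 n(n-1)$, with $\omega=z_{n-1,j}$ and $$A_p=\sum_{k=1,\,k\ne j}^{\frac12 n(n-1)}\frac1{(\omega-z_{n-1,k})^p}-\sum_{k=1}^{\frac12 n(n+1)}\frac1{(\omega-z_{n,k})^p},$$ one has $$A_1=0,\qquad A_2=\frac{\omega}{6},\qquad A_3=-\frac{n+1}{4},\qquad A_5=\omega\left(\frac{n+1}{24}-\frac1{36}\right).$$ For every $1\le j\le \tfrac12 n(n+1)$, with $\omega=z_{n,j}$ and $$B_p=\sum_{k=1}^{\frac12 n(n-1)}\frac1{(\omega-z_{n-1,k})^p}-\sum_{k=1,\,k\ne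 j}^{\frac12 n(n+1)}\frac1{(\omega-z_{n,k})^p},$$ one has $$B_1=0,\qquad B_2=-\frac{\omega}{6},\qquad B_3=-\frac{n-1}{4},\qquad B_5=\omega\left(\frac{n-1}{24}+\frac1{36}\right).$$ -/

import Mathlib

open Polynomial

/-- The Yablonskii–Vorob'ev polynomials over `ℂ`: `Q₀ = 1`, `Q₁ = z` and
`Qₙ₊₂ Qₙ = z Qₙ₊₁² - 4 (Qₙ₊₁ Qₙ₊₁'' - (Qₙ₊₁')²)`, solved for `Qₙ₊₂` by polynomial division
(that the division is exact is a property of the sequence, not part of this definition). -/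
noncomputable def yablonskiiVorobev : ℕ → ℂ[X]
  | 0 => 1
  | 1 => X
  | n + 2 =>
      (X * yablonskiiVorobev (n + 1) ^ 2
        - 4 * (yablonskiiVorobev (n + 1) * derivative (derivative (yablonskiiVorobev (n + 1)))
          - derivative (yablonskiiVorobev (n + 1)) ^ 2)) / yablonskiiVorobev n

/-- The finite set of complex roots of the `m`-th Yablonskii–Vorob'ev polynomial. -/
noncomputable def yvRoots (m : ℕ) : Finset ℂ :=
  (yablonskiiVorobev m).roots.toFinset

/-! Two consecutive polynomials `P`, `Q` of the sequence form a Hirota pair, with `ν` the index of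
`Q`. Dividing the bilinear equations by `PQ` gives `w² + (log PQ)'' = 0` and a third-order relation;
eliminating `(log PQ)''` leaves Painlevé II for `w = P'/P - Q'/Q`.

At a simple root `ω` of `P`, with `t = z - ω`, one has `w = 1/t + F`, and the Taylor coefficients of
`F` are the required power sums up to sign. Painlevé II gives them recursively: `F_k` enters with
factor `k(k-1) - 6 = (k-3)(k+2)`, so `F_3` stays free, which is why no relation for `p = 4` appears.
Swapping `P` and `Q` changes `ν` to `-ν` and handles the roots of `Q`.

That the pairs persist, with exact division and simple, disjoint roots, is an induction carried by
`IsHirotaPair.dvd_todaRHS`, `wronskian_eq` and `next`. -/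

/-- The bilinear (Hirota) form of the second Painlevé equation `w'' = 2 w³ + z w + ν` for
`w = P'/P - Q'/Q`. -/
structure IsHirotaPair (ν : ℂ) (P Q : ℂ[X]) : Prop where
  bilin_two : derivative (derivative P) * Q - 2 * (derivative P * derivative Q)
    + P * derivative (derivative Q) = 0
  bilin_three : derivative (derivative (derivative Q)) * P
    - 3 * (derivative (derivative Q) * derivative P)
    + 3 * (derivative Q * derivative (derivative P)) - Q * derivative (derivative (derivative P))
    - X * (derivative Q * P - Q * derivative P) + C ν * (Q * P) = 0

/-- The right-hand side of the Yablonskii–Vorob'ev recurrence. -/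
noncomputable def todaRHS (Q : ℂ[X]) : ℂ[X] :=
  X * Q ^ 2 - 4 * (Q * derivative (derivative Q) - derivative Q ^ 2)

theorem derivative_todaRHS (Q : ℂ[X]) :
    derivative (todaRHS Q) = Q ^ 2 + 2 * X * Q * derivative Q
      - 4 * (Q * derivative (derivative (derivative Q))
        - derivative Q * derivative (derivative Q)) := by
  simp only [todaRHS, derivative_mul, derivative_sub, pow_two, derivative_X, derivative_ofNat]
  ring

/-! ### Bäcklund step: from the pair `(P, Q)` to `(Q, U)`. -/

namespace IsHirotaPair

variable {ν : ℂ} {P Q U : ℂ[X]}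

theorem symm (h : IsHirotaPair ν P Q) : IsHirotaPair (-ν) Q P where
  bilin_two := by linear_combination h.bilin_two
  bilin_three := by rw [C_neg]; linear_combination -h.bilin_three

theorem derivative_bilin_two (h : IsHirotaPair ν P Q) :
    derivative (derivative (derivative P)) * Q - derivative (derivative P) * derivative Q
      - derivative P * derivative (derivative Q)
      + P * derivative (derivative (derivative Q)) = 0 := by
  have := congrArg derivative h.bilin_two
  simp only [derivative_mul, derivative_sub, derivative_add, derivative_ofNat,
    derivative_zero] at this
  linear_combination this

/-- The bilinear equations exhibit `P' * todaRHS Q` as a multiple of `P`; coprimality then removes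
`P'`. -/
theorem dvd_todaRHS (h : IsHirotaPair ν P Q) (hP : IsCoprime P (derivative P)) :
    P ∣ todaRHS Q := by
  refine hP.dvd_of_dvd_mul_left ?_
  refine ⟨Q * (-2 * derivative (derivative (derivative Q)) + X * derivative Q - C ν * Q)
    + 2 * derivative Q * derivative (derivative Q), ?_⟩
  unfold todaRHS
  linear_combination Q * h.bilin_three + Q * h.derivative_bilin_two - 2 * derivative Q * h.bilin_two

/-- Equivalently `(U/P)' = (2ν+1) Q²/P²`. This first-order identity replaces the quotient in all
later steps. -/
theorem wronskian_eq (h : IsHirotaPair ν P Q) (hP : P ≠ 0) (hU : U * P = todaRHS Q) :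
    derivative U * P - U * derivative P = (2 * C ν + 1) * Q ^ 2 := by
  have h' := congrArg derivative hU
  rw [derivative_todaRHS, derivative_mul] at h'
  rw [todaRHS] at hU
  apply mul_right_cancel₀ hP
  linear_combination P * h' - 2 * derivative P * hU - 2 * Q * h.bilin_three
    - 2 * Q * h.derivative_bilin_two + 4 * derivative Q * h.bilin_two

theorem next (h : IsHirotaPair ν P Q) (hP : P ≠ 0) (hU : U * P = todaRHS Q) :
    IsHirotaPair (ν + 1) Q U := by
  have J := h.wronskian_eq hP hU
  have J' := congrArg derivative J
  simp only [derivative_mul, derivative_sub, derivative_add, pow_two, derivative_C,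
    derivative_ofNat, derivative_one] at J'
  have J'' := congrArg derivative J'
  simp only [derivative_mul, derivative_sub, derivative_add, derivative_C,
    derivative_ofNat, derivative_one, derivative_zero] at J''
  have hC : C (ν + 1) = C ν + 1 := by simp
  have h1 : derivative (derivative Q) * U - 2 * (derivative Q * derivative U)
      + Q * derivative (derivative U) = 0 := by
    apply mul_right_cancel₀ hP
    linear_combination U * h.bilin_two - 2 * derivative Q * J + Q * J'
  -- Cancels the mixed terms `U''P' - U'P''` that `J''` carries besides `U'''P - UP'''`.
  have h2 : derivative U * derivative (derivative P) - derivative (derivative U) * derivative P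
      = -(2 * C ν + 1) * Q * derivative (derivative Q) := by
    apply mul_right_cancel₀ hP
    linear_combination derivative (derivative P) * J - derivative P * J'
      + (2 * C ν + 1) * Q * h.bilin_two
  have h1' := congrArg derivative h1
  simp only [derivative_mul, derivative_sub, derivative_add, derivative_ofNat,
    derivative_zero] at h1'
  refine ⟨h1, ?_⟩
  rw [hC]
  apply mul_right_cancel₀ hP
  rw [todaRHS] at hU
  linear_combination 2 * Q * J'' + 2 * Q * h2 - 4 * derivative Q * J'
    + 2 * derivative (derivative Q) * J - X * Q * J - U * h.bilin_three
    + U * h.derivative_bilin_two - P * h1' + (2 * C ν + 1) * Q * hU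

/-- Modulo `Q`, the product `UP` is `4Q'²`, a unit when `Q` is coprime to `Q'`. -/
theorem isCoprime_next (hQ : IsCoprime Q (derivative Q)) (hU : U * P = todaRHS Q) :
    IsCoprime Q U := by
  have h : IsCoprime Q (U * P) := by
    have h4 : IsCoprime Q (4 * derivative Q ^ 2) := by
      refine IsCoprime.mul_right ?_ hQ.pow_right
      have : (4 : ℂ[X]) = C 4 := (C_ofNat 4).symm
      rw [this]
      exact isCoprime_one_right.of_isCoprime_of_dvd_right
        (isUnit_C.2 (isUnit_iff_ne_zero.2 (by norm_num))).dvd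
    have e : U * P = 4 * derivative Q ^ 2 + Q * (X * Q - 4 * derivative (derivative Q)) := by
      rw [hU, todaRHS]; ring
    rw [e]
    exact h4.add_mul_left_right _
  exact h.of_mul_right_left

/-- Modulo `U`, the Wronskian identity reads `U'P = (2ν+1)Q²`, a unit since `Q` and `U` are coprime.
-/
theorem isCoprime_derivative_next (h : IsHirotaPair ν P Q) (hν : 2 * ν + 1 ≠ 0)
    (hP : P ≠ 0) (hQ : IsCoprime Q (derivative Q)) (hU : U * P = todaRHS Q) :
    IsCoprime U (derivative U) := by
  have h1 : IsCoprime U (C (2 * ν + 1) * Q ^ 2) :=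
    IsCoprime.mul_right (isCoprime_one_right.of_isCoprime_of_dvd_right
        (isUnit_C.2 (isUnit_iff_ne_zero.2 hν)).dvd)
      (isCoprime_next hQ hU).symm.pow_right
  have e : C (2 * ν + 1) * Q ^ 2 = derivative U * P + U * (-derivative P) := by
    have := h.wronskian_eq hP hU
    simp only [C_add, C_mul, C_1, C_ofNat]
    linear_combination -this
  rw [e] at h1
  exact (h1.of_add_mul_left_right).of_mul_right_left

end IsHirotaPair

/-! ### Degrees and the induction along the sequence. -/

theorem todaRHS_monic_natDegree {Q : ℂ[X]} (hQ : Q.Monic) :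
    (todaRHS Q).Monic ∧ (todaRHS Q).natDegree = 2 * Q.natDegree + 1 := by
  have hm : (X * Q ^ 2).Monic := monic_X.mul (hQ.pow 2)
  have hd : (X * Q ^ 2).natDegree = 2 * Q.natDegree + 1 := by
    rw [monic_X.natDegree_mul (hQ.pow 2), hQ.natDegree_pow, natDegree_X, add_comm]
  have hlt : (4 * (Q * derivative (derivative Q) - derivative Q ^ 2)).degree
      < (X * Q ^ 2).degree := by
    rw [degree_eq_natDegree hm.ne_zero, hd]
    refine lt_of_le_of_lt degree_le_natDegree (Nat.cast_lt.2 (Nat.lt_succ_of_le ?_))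
    have h1 := natDegree_derivative_le Q
    have h2 := natDegree_derivative_le (derivative Q)
    refine natDegree_mul_le.trans ?_
    rw [natDegree_ofNat, zero_add]
    refine (natDegree_sub_le _ _).trans (max_le (natDegree_mul_le.trans ?_)
      (natDegree_pow_le.trans ?_)) <;> omega
  exact ⟨hm.sub_of_left hlt, 
    (natDegree_eq_of_degree_eq (degree_sub_eq_left_of_degree_lt hlt)).trans hd⟩

theorem yablonskiiVorobev_induction (n : ℕ) :
    IsHirotaPair (n + 1 : ℕ) (yablonskiiVorobev n) (yablonskiiVorobev (n + 1)) ∧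
    (yablonskiiVorobev n).Monic ∧ (yablonskiiVorobev (n + 1)).Monic ∧
    IsCoprime (yablonskiiVorobev n) (derivative (yablonskiiVorobev n)) ∧
    IsCoprime (yablonskiiVorobev (n + 1)) (derivative (yablonskiiVorobev (n + 1))) ∧
    IsCoprime (yablonskiiVorobev n) (yablonskiiVorobev (n + 1)) ∧
    2 * (yablonskiiVorobev n).natDegree = (n + 1) * n ∧
    2 * (yablonskiiVorobev (n + 1)).natDegree = (n + 1) * (n + 2) ∧
    yablonskiiVorobev (n + 2) * yablonskiiVorobev n = todaRHS (yablonskiiVorobev (n + 1)) := by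
  have toda : ∀ n (ν : ℂ), IsHirotaPair ν (yablonskiiVorobev n) (yablonskiiVorobev (n + 1)) →
      IsCoprime (yablonskiiVorobev n) (derivative (yablonskiiVorobev n)) →
      yablonskiiVorobev (n + 2) * yablonskiiVorobev n
        = todaRHS (yablonskiiVorobev (n + 1)) := by
    intro n ν h hP
    have e : yablonskiiVorobev (n + 2)
        = todaRHS (yablonskiiVorobev (n + 1)) / yablonskiiVorobev n := by
      rw [yablonskiiVorobev, todaRHS]
    rw [e, mul_comm]
    exact EuclideanDomain.mul_div_cancel' (fun h0 => by
      rw [h0, derivative_zero] at hP; exact not_isCoprime_zero_zero hP) (h.dvd_todaRHS hP)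
  induction n with
  | zero =>
    have h : IsHirotaPair (0 + 1 : ℕ) (yablonskiiVorobev 0) (yablonskiiVorobev (0 + 1)) := by
      constructor <;> simp [yablonskiiVorobev]
    have h0 : IsCoprime (yablonskiiVorobev 0) (derivative (yablonskiiVorobev 0)) := by
      simp [yablonskiiVorobev, isCoprime_one_left]
    refine ⟨h, ?_, ?_, h0, ?_, ?_, ?_, ?_, toda 0 _ h h0⟩
    · simp [yablonskiiVorobev]
    · simp [yablonskiiVorobev, monic_X]
    · simp [yablonskiiVorobev, isCoprime_one_right]
    · simp [yablonskiiVorobev, isCoprime_one_left]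
    · simp [yablonskiiVorobev]
    · simp [yablonskiiVorobev]
  | succ n ih =>
    obtain ⟨h, mP, mQ, cP, cQ, -, dP, dQ, hU⟩ := ih
    have hn := h.next mP.ne_zero hU
    have hn' : IsHirotaPair (n + 1 + 1 : ℕ) (yablonskiiVorobev (n + 1))
        (yablonskiiVorobev (n + 1 + 1)) := by
      rw [Nat.cast_succ (n + 1)]; exact hn
    obtain ⟨mR, dR⟩ := todaRHS_monic_natDegree mQ
    rw [← hU] at mR dR
    have mU : (yablonskiiVorobev (n + 2)).Monic := mP.of_mul_monic_right mR
    rw [mU.natDegree_mul mP] at dR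
    refine ⟨hn', mQ, mU, cQ, ?_, IsHirotaPair.isCoprime_next cQ hU, ?_, ?_, toda _ _ hn' cQ⟩
    · refine h.isCoprime_derivative_next ?_ mP.ne_zero cQ hU
      exact_mod_cast Nat.succ_ne_zero (2 * (n + 1))
    · linarith
    · nlinarith

/-! ### Local expansion of Painlevé II at a simple pole. -/

section PowerSeriesLemmas

open PowerSeries

theorem powerSeries_coeff_of_painleve_two {ω ν : ℂ} {F : PowerSeries ℂ}
    (hF : PowerSeries.X ^ 2 * d⁄dX ℂ (d⁄dX ℂ F) = 6 * F + 6 * PowerSeries.X * F ^ 2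
      + 2 * PowerSeries.X ^ 2 * F ^ 3
      + (PowerSeries.C ω + PowerSeries.X) * (PowerSeries.X + PowerSeries.X ^ 2 * F)
      + PowerSeries.C ν * PowerSeries.X ^ 2) :
    PowerSeries.coeff 0 F = 0 ∧ PowerSeries.coeff 1 F = -ω / 6 ∧
      PowerSeries.coeff 2 F = -(ν + 1) / 4 ∧
      PowerSeries.coeff 4 F = ω * ((ν + 1) / 24 - 1 / 36) := by
  have h0 : PowerSeries.constantCoeff F = 0 := by
    have := congrArg PowerSeries.constantCoeff hF
    simpa [show (PowerSeries.constantCoeff (6 : PowerSeries ℂ) : ℂ) = 6 from map_ofNat _ 6] using this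
  obtain ⟨G, rfl⟩ : ∃ G, F = PowerSeries.X * G := PowerSeries.X_dvd_iff.2 h0
  have key : PowerSeries.X * d⁄dX ℂ (d⁄dX ℂ (PowerSeries.X * G)) = PowerSeries.C 6 * G
      + PowerSeries.X * (PowerSeries.X * (PowerSeries.C 6 * (G * G)))
      + PowerSeries.X * (PowerSeries.X * (PowerSeries.X * (PowerSeries.X *
        (PowerSeries.C 2 * G ^ 3))))
      + PowerSeries.C ω + PowerSeries.X * (PowerSeries.X * (PowerSeries.C ω * G))
      + PowerSeries.X * (1 + PowerSeries.X * (PowerSeries.X * G))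
      + PowerSeries.X * PowerSeries.C ν := by
    apply mul_left_cancel₀ (PowerSeries.X_ne_zero (R := ℂ))
    simp only [map_ofNat]
    linear_combination hF
  -- Coefficient 2 is skipped: there `6 * G_2` occurs on both sides, the resonance.
  have k0 := congrArg (PowerSeries.coeff 0) key
  have k1 := congrArg (PowerSeries.coeff 1) key
  have k3 := congrArg (PowerSeries.coeff 3) key
  simp only [map_add, PowerSeries.coeff_succ_X_mul, PowerSeries.coeff_zero_X_mul,
    PowerSeries.coeff_derivative, PowerSeries.coeff_C_mul, PowerSeries.coeff_C,
    PowerSeries.coeff_one] at k0 k1 k3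
  simp at k0 k1 k3
  have e1 : PowerSeries.constantCoeff G = -ω / 6 := by linear_combination -k0 / 6
  have e2 : PowerSeries.coeff 1 G = -(ν + 1) / 4 := by linear_combination -k1 / 4
  have e3 : PowerSeries.coeff 1 (G * G)
      = 2 * (PowerSeries.constantCoeff G * PowerSeries.coeff 1 G) := by
    rw [PowerSeries.coeff_mul]
    simp [Finset.Nat.antidiagonal_succ]
    ring
  rw [e3, e1, e2] at k3
  simp only [PowerSeries.coeff_succ_X_mul, PowerSeries.coeff_zero_X_mul, true_and]
  refine ⟨by simpa using e1, e2, ?_⟩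
  linear_combination k3 / 6

/-- The power sums of the inverses of `ω - a`, as a power series: the Taylor expansion at `ω` of
the logarithmic derivative of `∏ a ∈ s, (z - a)`. -/
noncomputable def logDerivSeries (ω : ℂ) (s : Finset ℂ) : PowerSeries ℂ :=
  PowerSeries.mk fun k => (-1) ^ k * ∑ a ∈ s, 1 / (ω - a) ^ (k + 1)

theorem X_add_C_mul_logDerivSeries_singleton {ω a : ℂ} (h : ω ≠ a) :
    (PowerSeries.X + PowerSeries.C (ω - a)) * logDerivSeries ω {a} = 1 := by
  have h' : ω - a ≠ 0 := sub_ne_zero.2 h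
  ext k
  rw [add_mul, map_add, PowerSeries.coeff_C_mul, PowerSeries.coeff_one]
  cases k with
  | zero => simp [logDerivSeries, h']
  | succ k =>
    rw [PowerSeries.coeff_succ_X_mul]
    simp only [logDerivSeries, PowerSeries.coeff_mk, Finset.sum_singleton]
    field_simp
    simp
    ring

theorem logDerivSeries_insert {ω a : ℂ} {s : Finset ℂ} (h : a ∉ s) :
    logDerivSeries ω (insert a s) = logDerivSeries ω {a} + logDerivSeries ω s := by
  ext k
  simp [logDerivSeries, Finset.sum_insert h, mul_add]

theorem derivative_prod_X_add_C {ω : ℂ} {s : Finset ℂ} (h : ω ∉ s) :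
    d⁄dX ℂ (∏ a ∈ s, (PowerSeries.X + PowerSeries.C (ω - a)))
      = (∏ a ∈ s, (PowerSeries.X + PowerSeries.C (ω - a))) * logDerivSeries ω s := by
  induction s using Finset.induction_on with
  | empty =>
    simp only [Finset.prod_empty, PowerSeries.derivative_one, one_mul]
    ext; simp [logDerivSeries]
  | insert a s ha ih =>
    rw [Finset.mem_insert, not_or] at h
    have h1 := X_add_C_mul_logDerivSeries_singleton h.1
    rw [Finset.prod_insert ha, Derivation.leibniz, ih h.2, logDerivSeries_insert ha]
    simp only [smul_eq_mul, map_add, PowerSeries.derivative_X, PowerSeries.derivative_C]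
    linear_combination -(∏ a ∈ s, (PowerSeries.X + PowerSeries.C (ω - a))) * h1

theorem prod_X_add_C_ne_zero (ω : ℂ) (s : Finset ℂ) :
    ∏ a ∈ s, (PowerSeries.X + PowerSeries.C (ω - a)) ≠ 0 := by
  refine Finset.prod_ne_zero_iff.2 fun a _ h => ?_
  have := congrArg (PowerSeries.coeff 1) h
  simp at this

/-- Taylor expansion of a polynomial at `ω`, as a power series. -/
noncomputable def taylorSeries (ω : ℂ) : ℂ[X] →+* PowerSeries ℂ :=
  Polynomial.coeToPowerSeries.ringHom.comp (taylorAlgHom ω : ℂ[X] →+* ℂ[X])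

theorem taylorSeries_C (ω a : ℂ) : taylorSeries ω (Polynomial.C a) = PowerSeries.C a := by
  simp [taylorSeries]

theorem taylorSeries_X (ω : ℂ) : taylorSeries ω Polynomial.X = PowerSeries.X + PowerSeries.C ω := by
  simp [taylorSeries]

theorem taylorSeries_derivative (ω : ℂ) (P : ℂ[X]) :
    taylorSeries ω (derivative P) = d⁄dX ℂ (taylorSeries ω P) := by
  simp [taylorSeries, PowerSeries.derivative_coe, taylor_apply, derivative_comp]

theorem taylorSeries_prod_X_sub_C (ω : ℂ) (s : Finset ℂ) :
    taylorSeries ω (∏ a ∈ s, (Polynomial.X - Polynomial.C a)) = ∏ a ∈ s, (PowerSeries.X + PowerSeries.C (ω - a)) := by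
  simp only [map_prod, map_sub, taylorSeries_C, taylorSeries_X, add_sub_assoc]

/-- `F` is the regular part of `w = 1/t + F = P'/P - Q'/Q`, where `P = t p`. -/
theorem painleve_two_of_bilinear {ω ν : ℂ} {p q f g : PowerSeries ℂ}
    (hp0 : p ≠ 0) (hq0 : q ≠ 0) (hp : d⁄dX ℂ p = p * f) (hq : d⁄dX ℂ q = q * g)
    (h2 : d⁄dX ℂ (d⁄dX ℂ (PowerSeries.X * p)) * q
      - 2 * (d⁄dX ℂ (PowerSeries.X * p) * d⁄dX ℂ q)
      + (PowerSeries.X * p) * d⁄dX ℂ (d⁄dX ℂ q) = 0)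
    (h3 : d⁄dX ℂ (d⁄dX ℂ (d⁄dX ℂ q)) * (PowerSeries.X * p)
      - 3 * (d⁄dX ℂ (d⁄dX ℂ q) * d⁄dX ℂ (PowerSeries.X * p))
      + 3 * (d⁄dX ℂ q * d⁄dX ℂ (d⁄dX ℂ (PowerSeries.X * p)))
      - q * d⁄dX ℂ (d⁄dX ℂ (d⁄dX ℂ (PowerSeries.X * p)))
      - (PowerSeries.X + PowerSeries.C ω) *
        (d⁄dX ℂ q * (PowerSeries.X * p) - q * d⁄dX ℂ (PowerSeries.X * p))
      + PowerSeries.C ν * (q * (PowerSeries.X * p)) = 0) :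
    PowerSeries.X ^ 2 * d⁄dX ℂ (d⁄dX ℂ (f - g)) = 6 * (f - g) + 6 * PowerSeries.X * (f - g) ^ 2
      + 2 * PowerSeries.X ^ 2 * (f - g) ^ 3
      + (PowerSeries.C ω + PowerSeries.X) * (PowerSeries.X + PowerSeries.X ^ 2 * (f - g))
      + PowerSeries.C ν * PowerSeries.X ^ 2 := by
  simp only [Derivation.leibniz, map_add, hp, hq, smul_eq_mul, PowerSeries.derivative_X, mul_one] at h2 h3
  have e2 : 2 * (f - g) + PowerSeries.X * ((f - g) ^ 2 + d⁄dX ℂ f + d⁄dX ℂ g) = 0 := by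
    apply mul_left_cancel₀ (mul_ne_zero hp0 hq0)
    linear_combination h2
  have e3 : -PowerSeries.X * ((f - g) ^ 3 + 3 * (f - g) * (d⁄dX ℂ f + d⁄dX ℂ g)
        + (d⁄dX ℂ (d⁄dX ℂ f) - d⁄dX ℂ (d⁄dX ℂ g)))
      - 3 * (f - g) ^ 2 - 3 * (d⁄dX ℂ f + d⁄dX ℂ g)
      + (PowerSeries.X + PowerSeries.C ω) * (1 + PowerSeries.X * (f - g))
      + PowerSeries.C ν * PowerSeries.X = 0 := by
    apply mul_left_cancel₀ (mul_ne_zero hp0 hq0)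
    linear_combination h3
  rw [map_sub, map_sub]
  -- The factor `X * (f - g) + 1` is `t w`; this multiple of `e2` eliminates `f' + g'`.
  linear_combination -PowerSeries.X * e3 - 3 * (PowerSeries.X * (f - g) + 1) * e2

end PowerSeriesLemmas

/-! ### From Hirota pairs to power sums over roots. -/

/-- The relations at a root `ω` of the first polynomial of a Hirota pair with simple roots. -/
theorem IsHirotaPair.sum_inv_pow {ν ω : ℂ} {s t : Finset ℂ}
    (h : IsHirotaPair ν (∏ a ∈ s, (X - C a)) (∏ b ∈ t, (X - C b))) (hs : ω ∈ s) (ht : ω ∉ t) :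
    ∑ a ∈ s.erase ω, 1 / (ω - a) - ∑ b ∈ t, 1 / (ω - b) = 0 ∧
    ∑ a ∈ s.erase ω, 1 / (ω - a) ^ 2 - ∑ b ∈ t, 1 / (ω - b) ^ 2 = ω / 6 ∧
    ∑ a ∈ s.erase ω, 1 / (ω - a) ^ 3 - ∑ b ∈ t, 1 / (ω - b) ^ 3 = -(ν + 1) / 4 ∧
    ∑ a ∈ s.erase ω, 1 / (ω - a) ^ 5 - ∑ b ∈ t, 1 / (ω - b) ^ 5
      = ω * ((ν + 1) / 24 - 1 / 36) := by
  have hP : taylorSeries ω (∏ a ∈ s, (X - C a)) = PowerSeries.X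
      * ∏ a ∈ s.erase ω, (PowerSeries.X + PowerSeries.C (ω - a)) := by
    rw [taylorSeries_prod_X_sub_C, ← Finset.mul_prod_erase s _ hs, sub_self, map_zero, add_zero]
  have h2 := congrArg (taylorSeries ω) h.bilin_two
  have h3 := congrArg (taylorSeries ω) h.bilin_three
  simp only [map_add, map_sub, map_mul, map_ofNat, map_zero, taylorSeries_derivative,
    taylorSeries_C, taylorSeries_X] at h2 h3
  rw [hP, taylorSeries_prod_X_sub_C] at h2 h3
  obtain ⟨c0, c1, c2, c4⟩ := powerSeries_coeff_of_painleve_two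
    (painleve_two_of_bilinear (prod_X_add_C_ne_zero ω _) (prod_X_add_C_ne_zero ω t)
      (derivative_prod_X_add_C (Finset.notMem_erase ω s)) (derivative_prod_X_add_C ht) h2 h3)
  simp only [logDerivSeries, map_sub, PowerSeries.coeff_mk] at c0 c1 c2 c4
  norm_num at c0 c1 c2 c4
  norm_num
  -- The factor `(-1)^k` in `logDerivSeries` flips only the sign of the coefficient with `k = 1`.
  exact ⟨c0, by linear_combination -c1, by linear_combination c2, by linear_combination c4⟩

theorem eq_prod_X_sub_C_of_isCoprime_derivative {P : ℂ[X]} (hm : P.Monic)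
    (h : IsCoprime P (derivative P)) : P = ∏ a ∈ P.roots.toFinset, (X - C a) := by
  have hn : P.roots.Nodup := nodup_roots h
  conv_lhs => rw [(IsAlgClosed.splits P).eq_prod_roots_of_monic hm]
  rw [Finset.prod, Multiset.toFinset_val, hn.dedup]

theorem card_roots_toFinset_of_isCoprime_derivative {P : ℂ[X]}
    (h : IsCoprime P (derivative P)) : P.roots.toFinset.card = P.natDegree := by
  rw [Multiset.toFinset_card_of_nodup (nodup_roots h), (IsAlgClosed.splits P).natDegree_eq_card_roots]

theorem disjoint_roots_toFinset_of_isCoprime {P Q : ℂ[X]} (h : IsCoprime P Q) :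
    Disjoint P.roots.toFinset Q.roots.toFinset := by
  rw [Finset.disjoint_left]
  intro a ha hb
  rw [Multiset.mem_toFinset] at ha hb
  have ha := (isRoot_of_mem_roots ha).eq_zero
  have hb := (isRoot_of_mem_roots hb).eq_zero
  obtain ⟨u, v, huv⟩ := h
  have := congrArg (eval a) huv
  simp [ha, hb] at this

theorem mainTheorem3 (n : ℕ) (hn : 1 ≤ n) :
    -- the recurrence holds exactly, so that the sequence really consists of polynomials
    yablonskiiVorobev (n + 1) * yablonskiiVorobev (n - 1)
      = X * yablonskiiVorobev n ^ 2
        - 4 * (yablonskiiVorobev n * derivative (derivative (yablonskiiVorobev n))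
          - derivative (yablonskiiVorobev n) ^ 2) ∧
    -- degrees, simplicity of the roots, no common roots
    (yablonskiiVorobev (n - 1)).natDegree = n * (n - 1) / 2 ∧
    (yvRoots (n - 1)).card = n * (n - 1) / 2 ∧
    (yablonskiiVorobev n).natDegree = n * (n + 1) / 2 ∧
    (yvRoots n).card = n * (n + 1) / 2 ∧
    Disjoint (yvRoots (n - 1)) (yvRoots n) ∧
    -- relations at the roots of the polynomial of index `n - 1`
    (∀ ω ∈ yvRoots (n - 1),
      ∑ a ∈ (yvRoots (n - 1)).erase ω, 1 / (ω - a)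
          - ∑ b ∈ yvRoots n, 1 / (ω - b) = 0 ∧
      ∑ a ∈ (yvRoots (n - 1)).erase ω, 1 / (ω - a) ^ 2
          - ∑ b ∈ yvRoots n, 1 / (ω - b) ^ 2 = ω / 6 ∧
      ∑ a ∈ (yvRoots (n - 1)).erase ω, 1 / (ω - a) ^ 3
          - ∑ b ∈ yvRoots n, 1 / (ω - b) ^ 3 = -((n : ℂ) + 1) / 4 ∧
      ∑ a ∈ (yvRoots (n - 1)).erase ω, 1 / (ω - a) ^ 5
          - ∑ b ∈ yvRoots n, 1 / (ω - b) ^ 5 = ω * (((n : ℂ) + 1) / 24 - 1 / 36)) ∧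
    -- relations at the roots of the polynomial of index `n`
    (∀ ω ∈ yvRoots n,
      ∑ a ∈ yvRoots (n - 1), 1 / (ω - a)
          - ∑ b ∈ (yvRoots n).erase ω, 1 / (ω - b) = 0 ∧
      ∑ a ∈ yvRoots (n - 1), 1 / (ω - a) ^ 2
          - ∑ b ∈ (yvRoots n).erase ω, 1 / (ω - b) ^ 2 = -ω / 6 ∧
      ∑ a ∈ yvRoots (n - 1), 1 / (ω - a) ^ 3
          - ∑ b ∈ (yvRoots n).erase ω, 1 / (ω - b) ^ 3 = -((n : ℂ) - 1) / 4 ∧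
      ∑ a ∈ yvRoots (n - 1), 1 / (ω - a) ^ 5
          - ∑ b ∈ (yvRoots n).erase ω, 1 / (ω - b) ^ 5 = ω * (((n : ℂ) - 1) / 24 + 1 / 36)) := by
  obtain ⟨n, rfl⟩ : ∃ m, n = m + 1 := ⟨n - 1, by omega⟩
  obtain ⟨h, mP, mQ, cP, cQ, cPQ, dP, dQ, hU⟩ := yablonskiiVorobev_induction n
  have hdisj : Disjoint (yvRoots n) (yvRoots (n + 1)) := disjoint_roots_toFinset_of_isCoprime cPQ
  have dP' : (yablonskiiVorobev n).natDegree = (n + 1) * n / 2 := by omega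
  have dQ' : (yablonskiiVorobev (n + 1)).natDegree = (n + 1) * (n + 2) / 2 := by omega
  replace h : IsHirotaPair (n + 1 : ℕ) (∏ a ∈ yvRoots n, (X - C a))
      (∏ b ∈ yvRoots (n + 1), (X - C b)) := by
    rwa [eq_prod_X_sub_C_of_isCoprime_derivative mP cP,
      eq_prod_X_sub_C_of_isCoprime_derivative mQ cQ] at h
  simp only [Nat.add_sub_cancel]
  refine ⟨hU, dP', (card_roots_toFinset_of_isCoprime_derivative cP).trans dP', dQ',
    (card_roots_toFinset_of_isCoprime_derivative cQ).trans dQ', hdisj, fun ω hω => ?_,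
    fun ω hω => ?_⟩
  · exact h.sum_inv_pow hω (Finset.disjoint_left.1 hdisj hω)
  -- The swapped pair has parameter `-ν`, and its sums are the negatives of the required ones.
  · obtain ⟨h1, h2, h3, h5⟩ := h.symm.sum_inv_pow hω (Finset.disjoint_right.1 hdisj hω)
    exact ⟨by linear_combination -h1, by linear_combination -h2, by linear_combination -h3,
      by linear_combination -h5⟩
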